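/- **Theorem 4.** For $a\in\mathbb R^3$ let $\lfloor a\rfloor$ denote the skew-symmetric matrix with $\lfloor a\rfloor b=a\times b$. Let $C_1,\dots,C_M\in\mathbb R^{4\times4}$ be symmetric and let $T_j=\begin{bmatrix}R_j&t_j\\0&1\end{bmatrix}\in SE(3)$, $j=1,\dots,M$. For a symmetric matrix $C=\begin{bmatrix}P&v\\v^T&N\end{bmatrix}\in\mathbb R^{4\times 4}$ with $P\in\mathbb R^{3\times3}$ and $N\ne0$ put $A(C)=\frac1NP-\frac1{N^2}vv^T$, and let $\lambda_l(A)$ denote the $l$-th largest eigenvalue of a symmetric $3\times 3$ matrix $A$ (counted with multiplicity). Consider the cost $c(T)=\lambda_l\big(A(\sum_jT_jC_jT_j^T)\big)$ of $T=(T_1,\dots,T_M)$. Perturb the poses by $\delta T=(\delta T_1,\dots,\delta T_M)\in\mathbb R^{6M}$, $\delta T_j=(\delta\phi_j,\delta t_j)\in\mathbb R^3\times\mathbb R^3$, through $$(T\boxplus\delta T)_j=\big(\exp(\lfloor\delta\phi_j\rfloor)R_j,\ \delta t_j+\exp(\lfloor\delta\phi_j\rfloor)t_j\big),$$ and let the Jacobian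 $J\in\mathbb R^{1\times6M}$ and the Hessian $H\in\mathbb R^{6M\times6M}$ of $c$ at $T$ be those of $\delta T\mapsto c(T\boxplus\delta T)$ at $\delta T=0$. At the given $T$ let $C=\begin{bmatrix}P&v\\v^T&N\end{bmatrix}=\sum_jT_jC_jT_j^T$, assume $N\neq0$, let $\lambda_1\ge\lambda_2\ge\lambda_3$ be the eigenvalues of $A(C)$ with orthonormal eigenvectors $u_1,u_2,u_3$, and assume $\lambda_k\ne\lambda_l$ for all $k\neq l$. Then $\delta T\mapsto c(T\boxplus\delta T)$ is twice differentiable at $0$, and $$J=g_{ll},\qquad H=H_{ll}+\sum_{k\ne l}\frac{2}{\lambda_l-\lambda_k}\,g_{kl}^Tg_{kl}.$$ Here, with $$S=\begin{bmatrix}I_3&0_{3\times 1}\end{bmatrix},\quad F=\begin{bmatrix}0_{3\times 3}&0\\0&1\end{bmatrix},\quad U_k=\begin{bmatrix}-\lfloor u_k\rfloor&0_{3\times 1}\\0_{3\times 3}&u_k\end{bmatrix}\in\mathbb R^{6\times4},$$ the row $g_{kl}=[\cdots\ g_{kl}^q\ \cdots]\in\mathbb R^{1\times6M}$ has the blocks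 $$g_{kl}^q=\tfrac1Nu_l^TS(T_q-\tfrac1NCF)C_qT_q^TU_k^T+\tfrac1Nu_k^TS(T_q-\tfrac1NCF)C_qT_q^TU_l^T,$$ and $H_{ll}\in\mathbb R^{6M\times6M}$ has the $6\times6$ blocks $$H_{ll}^{p,q}=-\tfrac2{N^2}U_lT_pC_pFC_qT_q^TU_l^T+\mathbb 1_{p=q}\Big(\tfrac2NU_lT_qC_qT_q^TU_l^T+\begin{bmatrix}K^q&0\\0&0\end{bmatrix}\Big),$$ $$K^q=\tfrac1N\lfloor a_q\rfloor\lfloor u_l\rfloor+\tfrac1N\lfloor u_l\rfloor\lfloor a_q\rfloor,\qquad a_q=ST_qC_q(T_q-\tfrac1NCF)^TS^Tu_l .$$ Moreover, $J\,\delta T=0$ and $\delta T^TH\,\delta T=0$ for every $\delta T=(w,\dots,w)$ with $w\in\mathbb R^6$; and $J^p=0$ whenever $C_p=0$, and $H^{p,q}=0$ whenever $C_p=0$ or $C_q=0$, where $J^p\in\mathbb R^{1\times 6}$ and $H^{p,q}\in\mathbb R^{6\times 6}$ denote the blocks of $J$ and $H$. -/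

import Mathlib

open Matrix Topology

namespace LidarBA

/-- Row and column index of a homogeneous `4 × 4` matrix, split as `3 + 1`. -/
abbrev I4 : Type := Fin 3 ⊕ Fin 1

/-- Index of the perturbation of one pose, split as rotation (`inl`) and translation (`inr`). -/
abbrev I6 : Type := Fin 3 ⊕ Fin 3

/-- Index of the stacked perturbation in `ℝ^{6M}` of `M` poses. -/
abbrev Idx (M : ℕ) : Type := Fin M × I6

/-- The skew-symmetric matrix `⌊a⌋` with `⌊a⌋ b = a × b`. -/
def skew (a : Fin 3 → ℝ) : Matrix (Fin 3) (Fin 3) ℝ :=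
  !![0, -a 2, a 1; a 2, 0, -a 0; -a 1, a 0, 0]

theorem skew_transpose (a : Fin 3 → ℝ) : (skew a)ᵀ = -skew a := by
  ext i j
  fin_cases i <;> fin_cases j <;> simp [skew]

theorem skew_add (a b : Fin 3 → ℝ) : skew (a + b) = skew a + skew b := by
  ext i j
  fin_cases i <;> fin_cases j <;> simp [skew] <;> ring

/-- The rotation group `SO(3)`. -/
abbrev SO3 : Type := Matrix.specialOrthogonalGroup (Fin 3) ℝ

theorem exp_skew_mul_transpose (a : Fin 3 → ℝ) :
    NormedSpace.exp (skew a) * (NormedSpace.exp (skew a))ᵀ = 1 := by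
  rw [← Matrix.exp_transpose, skew_transpose,
    ← Matrix.exp_add_of_commute _ _ ((Commute.refl (skew a)).neg_right), add_neg_cancel,
    NormedSpace.exp_zero]

theorem exp_skew_mem (a : Fin 3 → ℝ) :
    NormedSpace.exp (skew a) ∈ Matrix.specialOrthogonalGroup (Fin 3) ℝ := by
  rw [Matrix.mem_specialOrthogonalGroup_iff]
  refine ⟨?_, ?_⟩
  · rw [Matrix.mem_orthogonalGroup_iff]
    exact exp_skew_mul_transpose a
  · have key : ∀ b : Fin 3 → ℝ, (NormedSpace.exp (skew b)).det ^ 2 = 1 := by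
      intro b
      have h := congrArg Matrix.det (exp_skew_mul_transpose b)
      rw [Matrix.det_mul, Matrix.det_transpose, Matrix.det_one] at h
      rw [sq, h]
    have half : skew a = skew ((1 / 2 : ℝ) • a) + skew ((1 / 2 : ℝ) • a) := by
      rw [← skew_add, ← add_smul]
      norm_num
    rw [half, Matrix.exp_add_of_commute _ _ (Commute.refl _), Matrix.det_mul, ← sq]
    exact key _

/-- The rotation `exp ⌊a⌋`, with the matrix exponential. -/
noncomputable def expRot (a : Fin 3 → ℝ) : SO3 :=
  ⟨NormedSpace.exp (skew a), exp_skew_mem a⟩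

/-- A pose, that is, an element `(R, t)` of `SE(3)`. -/
structure SE3 : Type where
  /-- the rotation `R` -/
  rot : SO3
  /-- the translation `t` -/
  trans : Fin 3 → ℝ

/-- The homogeneous `4 × 4` matrix `[R t; 0 1]` of a pose. -/
def SE3.mat (T : SE3) : Matrix I4 I4 ℝ :=
  fromBlocks T.rot.1 (replicateCol (Fin 1) T.trans) 0 1

/-- The left perturbation of one pose by `(φ, τ)`: the pose `(exp ⌊φ⌋ R, τ + exp ⌊φ⌋ t)`. -/
noncomputable def SE3.boxplus (T : SE3) (d : I6 → ℝ) : SE3 where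
  rot := expRot (fun i => d (Sum.inl i)) * T.rot
  trans := (fun i => d (Sum.inr i)) + (expRot (fun i => d (Sum.inl i))).1 *ᵥ T.trans

/-- The left perturbation of a vector of poses. -/
noncomputable def boxplus {M : ℕ} (T : Fin M → SE3) (d : Idx M → ℝ) : Fin M → SE3 :=
  fun j => (T j).boxplus (fun a => d (j, a))

/-- Twice differentiability of a function of the poses at `T`, in the perturbation at zero. -/
def TwiceDifferentiableAt {M : ℕ} (f : (Fin M → SE3) → ℝ) (T : Fin M → SE3) : Prop :=
  (∀ᶠ d in 𝓝 (0 : Idx M → ℝ), DifferentiableAt ℝ (fun d => f (boxplus T d)) d) ∧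
    DifferentiableAt ℝ (fderiv ℝ (fun d => f (boxplus T d))) 0

/-- The Jacobian (a row vector) of a function of the poses at `T`. -/
noncomputable def jacobian {M : ℕ} (f : (Fin M → SE3) → ℝ) (T : Fin M → SE3) : Idx M → ℝ :=
  fun i => fderiv ℝ (fun d => f (boxplus T d)) 0 (Pi.single i 1)

/-- The Hessian matrix of a function of the poses at `T`: the second partial derivatives. -/
noncomputable def hessian {M : ℕ} (f : (Fin M → SE3) → ℝ) (T : Fin M → SE3) :
    Matrix (Idx M) (Idx M) ℝ :=
  Matrix.of fun i j =>
    fderiv ℝ (fun d => fderiv ℝ (fun d' => f (boxplus T d')) d (Pi.single i 1)) 0 (Pi.single j 1)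

/-- The lower right entry `N` of `C = [P v; vᵀ N]`. -/
def countN (C : Matrix I4 I4 ℝ) : ℝ := C (Sum.inr 0) (Sum.inr 0)

/-- The column `v` of `C = [P v; vᵀ N]`. -/
def sumV (C : Matrix I4 I4 ℝ) : Fin 3 → ℝ := fun i => C (Sum.inl i) (Sum.inr 0)

/-- `A(C) = P / N - v vᵀ / N²` for `C = [P v; vᵀ N]`. -/
noncomputable def covA (C : Matrix I4 I4 ℝ) : Matrix (Fin 3) (Fin 3) ℝ :=
  (1 / countN C) • C.toBlocks₁₁ - (1 / countN C ^ 2) • vecMulVec (sumV C) (sumV C)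

open Classical in
/-- The eigenvalues, with multiplicity, of a symmetric `3 × 3` matrix in decreasing order:
`eig A 0 ≥ eig A 1 ≥ eig A 2` (and zero if `A` is not symmetric). -/
noncomputable def eig (A : Matrix (Fin 3) (Fin 3) ℝ) (l : Fin 3) : ℝ :=
  if h : A.IsHermitian then h.eigenvalues₀ (Fin.cast (Fintype.card_fin 3).symm l) else 0

/-- The merged matrix `∑ j, T_j C_j T_jᵀ`. -/
def merged {M : ℕ} (C : Fin M → Matrix I4 I4 ℝ) (T : Fin M → SE3) : Matrix I4 I4 ℝ :=
  ∑ j, (T j).mat * C j * (T j).matᵀ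

theorem merged_isSymm {M : ℕ} (C : Fin M → Matrix I4 I4 ℝ) (hC : ∀ j, (C j).IsSymm)
    (T : Fin M → SE3) : (merged C T).IsSymm := by
  unfold merged Matrix.IsSymm
  rw [Matrix.transpose_sum]
  refine Finset.sum_congr rfl fun j _ => ?_
  rw [Matrix.transpose_mul, Matrix.transpose_mul, Matrix.transpose_transpose, (hC j).eq,
    Matrix.mul_assoc]

/-- Hence `eig` is applied to symmetric matrices only. -/
theorem covA_isHermitian {C : Matrix I4 I4 ℝ} (hC : C.IsSymm) : (covA C).IsHermitian := by
  ext i j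
  have h := hC.apply (Sum.inl i) (Sum.inl j)
  simp [covA, Matrix.toBlocks₁₁, vecMulVec_apply, h, mul_comm]

/-- The cost `T ↦ λ_l (A (∑ j, T_j C_j T_jᵀ))`. -/
noncomputable def cost {M : ℕ} (C : Fin M → Matrix I4 I4 ℝ) (l : Fin 3) (T : Fin M → SE3) : ℝ :=
  eig (covA (merged C T)) l

/-- `S_P = [I 0]`, of size `3 × 4`. -/
def SP : Matrix (Fin 3) I4 ℝ := fromCols 1 0

/-- `F = [0 0; 0 1]`, of size `4 × 4`. -/
def FF : Matrix I4 I4 ℝ := fromBlocks 0 0 0 1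

/-- `U = [-⌊u⌋ 0; 0 u]`, of size `6 × 4`. -/
def UU (u : Fin 3 → ℝ) : Matrix I6 I4 ℝ :=
  fromBlocks (-skew u) 0 0 (replicateCol (Fin 1) u)

section Formulas

variable {M : ℕ} (C : Fin M → Matrix I4 I4 ℝ) (T : Fin M → SE3)

/-- `T_q - (1/N) C F`, where `C` is the merged matrix and `N` its lower right entry. -/
noncomputable def centered (q : Fin M) : Matrix I4 I4 ℝ :=
  (T q).mat - (1 / countN (merged C T)) • (merged C T * FF)

/-- The block `g_{kl}^q` (a row of length `6`), with `uk = u_k` and `ul = u_l`. -/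
noncomputable def gBlock (uk ul : Fin 3 → ℝ) (q : Fin M) : I6 → ℝ :=
  (1 / countN (merged C T)) •
      (ul ᵥ* (SP * centered C T q * C q * (T q).matᵀ * (UU uk)ᵀ)) +
    (1 / countN (merged C T)) •
      (uk ᵥ* (SP * centered C T q * C q * (T q).matᵀ * (UU ul)ᵀ))

/-- The row `g_{kl}` of length `6M`. -/
noncomputable def gRow (uk ul : Fin 3 → ℝ) : Idx M → ℝ :=
  fun i => gBlock C T uk ul i.1 i.2

/-- `D_{p,q} = C_p F C_q`. -/
def DD (p q : Fin M) : Matrix I4 I4 ℝ := C p * FF * C q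

/-- The block `K_{ll}^q`. -/
noncomputable def KBlock (ul : Fin 3 → ℝ) (q : Fin M) : Matrix (Fin 3) (Fin 3) ℝ :=
  (1 / countN (merged C T)) •
      (skew ((SP * (T q).mat * C q * (centered C T q)ᵀ * SPᵀ) *ᵥ ul) * skew ul) +
    (1 / countN (merged C T)) •
      (skew ul * skew ((SP * (T q).mat * C q * (centered C T q)ᵀ * SPᵀ) *ᵥ ul))

/-- The block `H_{ll}^{p,q}`. -/
noncomputable def HBlock (ul : Fin 3 → ℝ) (p q : Fin M) : Matrix I6 I6 ℝ :=
  -(2 / countN (merged C T) ^ 2) • (UU ul * (T p).mat * DD C p q * (T q).matᵀ * (UU ul)ᵀ) +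
    if p = q then
      (2 / countN (merged C T)) • (UU ul * (T q).mat * C q * (T q).matᵀ * (UU ul)ᵀ) +
        fromBlocks (KBlock C T ul q) 0 0 0
    else 0

/-- The matrix `H_{ll}` with the blocks `H_{ll}^{p,q}`. -/
noncomputable def HMat (ul : Fin 3 → ℝ) : Matrix (Idx M) (Idx M) ℝ :=
  Matrix.of fun i j => HBlock C T ul i.1 j.1 i.2 j.2

end Formulas

end LidarBA

open LidarBA

/-!
The perturbation `d` multiplies each homogeneous matrix `T_j` on the left by a rigid motion. The
lower right entry `N` of the merged matrix does not change, so `N ≠ 0` makes every entry of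
`A(d) = A(C(T ⊞ d))` a `C²` function of `d` on the whole space.

Let the rows of the orthogonal matrix `U` be the eigenvectors of `A(0)`, and let
`B_ik(d) = u_iᵀ A(d) u_k` be the entries of `A(d)` in this basis. The `l`-th eigenvalue `μ(d)` is
a root of `det (B(d) - x) = 0`, simple at `d = 0`. Weyl's inequality (`eig_le_add`) shows that the
ordered eigenvalue is continuous, hence it is the implicit function of this equation near `0`, and
so it is `C²` (`contDiffAt_eig`).

The derivatives are computed along lines `s ↦ s w`, through values and first two derivatives at
`0` of functions of one variable (`HasJetTwo`). All off-diagonal entries of `B - μ` vanish at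
`s = 0`, and so does the `l`-th diagonal entry. Expanding `det (B - μ) = 0` to second order
therefore gives `μ' = B_ll'` and `μ'' = B_ll'' + ∑_{k ≠ l} 2 (B_kl')² / (λ_l - λ_k)`
(`jet_of_det_eq_zero`, `jet_cost`). Along a line the rotations are `exp (s ⌊φ⌋)`, and an entry
`xᵀ A y` is a quadratic expression in the pulled back vectors `Gᵀ (x, 0)`, `Gᵀ (y, 0)`, where `G`
is the perturbing motion. Their first derivative is given by `UU x`, `UU y`, and the product rule
identifies `B_kl'` with `gRow` (`exists_hasJetTwo_covA`) and `B_ll''` with the quadratic form of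
`HMat` (`hasJetTwo_covA_self`). Since the matrices are symmetric, their quadratic forms determine
them (`eq_of_forall_quadForm`).

When all poses move by the same rigid motion, `A` is conjugated by a rotation
(`covA_merged_boxplus_const`), so that the cost is constant along the corresponding lines and its
derivatives along them vanish.
-/

namespace LidarBA

/-! ### Entries of the matrix exponential -/

section Exp

variable {𝔸 : Type*} [NormedRing 𝔸] [NormedAlgebra ℝ 𝔸] [FiniteDimensional ℝ 𝔸]

theorem hasDerivAt_linearMap_exp_smul (L : 𝔸 →ₗ[ℝ] ℝ) (X : 𝔸) (s : ℝ) :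
    HasDerivAt (fun s : ℝ => L (NormedSpace.exp (s • X))) (L (NormedSpace.exp (s • X) * X)) s :=
  have := FiniteDimensional.complete ℝ 𝔸
  L.toContinuousLinearMap.hasFDerivAt.comp_hasDerivAt s (hasDerivAt_exp_smul_const (𝕂 := ℝ) X s)

theorem contDiff_linearMap_exp (L : 𝔸 →ₗ[ℝ] ℝ) {E : Type*} [NormedAddCommGroup E]
    [NormedSpace ℝ E] [FiniteDimensional ℝ E] (K : E →ₗ[ℝ] 𝔸) :
    ContDiff ℝ 2 (fun x => L (NormedSpace.exp (K x))) := by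
  have := FiniteDimensional.complete ℝ 𝔸
  have h : ContDiff ℝ 2 (NormedSpace.exp (𝔸 := 𝔸)) :=
    contDiff_iff_contDiffAt.2 fun x => (NormedSpace.exp_analytic (𝕂 := ℝ) x).contDiffAt
  exact L.toContinuousLinearMap.contDiff.comp (h.comp K.toContinuousLinearMap.contDiff)

variable {n : Type*} [Fintype n] [DecidableEq n]

-- Matrices carry no global norm. The operator norm is passed explicitly, so that the statement
-- keeps the entrywise topology.
theorem hasDerivAt_exp_smul_apply (X : Matrix n n ℝ) (i j : n) (s : ℝ) :
    HasDerivAt (fun s : ℝ => NormedSpace.exp (s • X) i j) ((NormedSpace.exp (s • X) * X) i j) s :=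
  @hasDerivAt_linearMap_exp_smul (Matrix n n ℝ) Matrix.linftyOpNormedRing
    Matrix.linftyOpNormedAlgebra inferInstance (Matrix.entryLinearMap ℝ ℝ i j) X s

theorem contDiff_exp_apply {E : Type*} [NormedAddCommGroup E] [NormedSpace ℝ E]
    [FiniteDimensional ℝ E] (K : E →ₗ[ℝ] Matrix n n ℝ) (i j : n) :
    ContDiff ℝ 2 (fun x => NormedSpace.exp (K x) i j) :=
  @contDiff_linearMap_exp (Matrix n n ℝ) Matrix.linftyOpNormedRing
    Matrix.linftyOpNormedAlgebra inferInstance (Matrix.entryLinearMap ℝ ℝ i j) E _ _ _ K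

end Exp

/-! ### Second-order jets of functions of one variable -/

/-- The real function `f` has value `a`, first derivative `b` and second derivative `c` at `0`;
it is only required to be differentiable near `0` and twice differentiable at `0`. -/
def HasJetTwo (f : ℝ → ℝ) (a b c : ℝ) : Prop :=
  f 0 = a ∧ ∃ f' : ℝ → ℝ, (∀ᶠ s in 𝓝 0, HasDerivAt f (f' s) s) ∧ f' 0 = b ∧ HasDerivAt f' c 0

namespace HasJetTwo

variable {f g : ℝ → ℝ} {a b c a' b' c' : ℝ}

theorem congr_of_eventuallyEq (hf : HasJetTwo f a b c) (h : g =ᶠ[𝓝 0] f) :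
    HasJetTwo g a b c := by
  obtain ⟨h0, f', h1, h2, h3⟩ := hf
  refine ⟨h.self_of_nhds.trans h0, f', ?_, h2, h3⟩
  filter_upwards [h1, h.eventuallyEq_nhds] with s hs hs'
  exact hs.congr_of_eventuallyEq hs'

theorem unique (hf : HasJetTwo f a b c) (hg : HasJetTwo f a' b' c') :
    a = a' ∧ b = b' ∧ c = c' := by
  obtain ⟨h0, f', h1, h2, h3⟩ := hf
  obtain ⟨k0, g', k1, k2, k3⟩ := hg
  have e : f' =ᶠ[𝓝 0] g' := by
    filter_upwards [h1, k1] with s hs ks using hs.unique ks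
  exact ⟨h0.symm.trans k0, by rw [← h2, ← k2, e.self_of_nhds],
    h3.unique (k3.congr_of_eventuallyEq e)⟩

theorem const (a : ℝ) : HasJetTwo (fun _ => a) a 0 0 :=
  ⟨rfl, fun _ => 0, .of_forall fun s => hasDerivAt_const s a, rfl, hasDerivAt_const _ _⟩

theorem id_mul (a : ℝ) : HasJetTwo (fun s => s * a) 0 a 0 :=
  ⟨zero_mul a, fun _ => a, .of_forall fun s => by simpa using (hasDerivAt_id s).mul_const a, rfl,
    hasDerivAt_const _ _⟩

theorem add (hf : HasJetTwo f a b c) (hg : HasJetTwo g a' b' c') :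
    HasJetTwo (fun s => f s + g s) (a + a') (b + b') (c + c') := by
  obtain ⟨h0, f', h1, h2, h3⟩ := hf
  obtain ⟨k0, g', k1, k2, k3⟩ := hg
  refine ⟨by simp only [h0, k0], fun s => f' s + g' s, ?_, by simp only [h2, k2], h3.add k3⟩
  filter_upwards [h1, k1] with s hs ks using hs.add ks

theorem mul (hf : HasJetTwo f a b c) (hg : HasJetTwo g a' b' c') :
    HasJetTwo (fun s => f s * g s) (a * a') (b * a' + a * b') (c * a' + 2 * (b * b') + a * c') := by
  obtain ⟨h0, f', h1, h2, h3⟩ := hf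
  obtain ⟨k0, g', k1, k2, k3⟩ := hg
  refine ⟨by simp only [h0, k0], fun s => f' s * g s + f s * g' s, ?_,
    by simp only [h2, k2, h0, k0], ?_⟩
  · filter_upwards [h1, k1] with s hs ks using hs.mul ks
  · have := (h3.mul k1.self_of_nhds).add (h1.self_of_nhds.mul k3)
    rw [h0, h2, k0, k2] at this
    exact this.congr_deriv (by ring)

theorem const_mul (r : ℝ) (hf : HasJetTwo f a b c) :
    HasJetTwo (fun s => r * f s) (r * a) (r * b) (r * c) := by
  simpa using (const r).mul hf

theorem sub (hf : HasJetTwo f a b c) (hg : HasJetTwo g a' b' c') :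
    HasJetTwo (fun s => f s - g s) (a - a') (b - b') (c - c') := by
  simpa [sub_eq_add_neg] using hf.add (hg.const_mul (-1))

theorem sum {ι : Type*} {s : Finset ι} {f : ι → ℝ → ℝ} {a b c : ι → ℝ}
    (h : ∀ i ∈ s, HasJetTwo (f i) (a i) (b i) (c i)) :
    HasJetTwo (fun t => ∑ i ∈ s, f i t) (∑ i ∈ s, a i) (∑ i ∈ s, b i) (∑ i ∈ s, c i) := by
  classical
  induction s using Finset.induction_on with
  | empty => simpa using const 0
  | insert i s hi ih =>
    simp only [Finset.sum_insert hi]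
    exact (h i (by simp)).add (ih fun j hj => h j (by simp [hj]))

/-- The second-order jet of a `C²` function along the line through `0` in the direction `w`. -/
theorem of_contDiffAt {E : Type*} [NormedAddCommGroup E] [NormedSpace ℝ E] {F : E → ℝ}
    (hF : ContDiffAt ℝ 2 F 0) (w : E) :
    HasJetTwo (fun s => F (s • w)) (F 0) (fderiv ℝ F 0 w) (fderiv ℝ (fderiv ℝ F) 0 w w) := by
  have line : ∀ s : ℝ, HasDerivAt (fun s : ℝ => s • w) w s := fun s => by
    simpa using (hasDerivAt_id s).smul_const w
  have tend : Filter.Tendsto (fun s : ℝ => s • w) (𝓝 0) (𝓝 0) := by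
    simpa using (line 0).continuousAt.tendsto
  refine ⟨by simp, fun s => fderiv ℝ F (s • w) w, ?_, by simp, ?_⟩
  · have : ∀ᶠ d in 𝓝 (0 : E), DifferentiableAt ℝ F d :=
      (hF.eventually (by simp)).mono fun d hd => hd.differentiableAt (by simp)
    filter_upwards [tend.eventually this] with s hs
    exact hs.hasFDerivAt.comp_hasDerivAt s (line s)
  · have h1 : HasFDerivAt (fderiv ℝ F) (fderiv ℝ (fderiv ℝ F) 0) ((0 : ℝ) • w) := by
      rw [zero_smul]
      exact ((hF.fderiv_right (m := 1) (by norm_num)).differentiableAt (by simp)).hasFDerivAt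
    have h2 : HasDerivAt (fun s : ℝ => fderiv ℝ F (s • w)) (fderiv ℝ (fderiv ℝ F) 0 w) 0 :=
      h1.comp_hasDerivAt (0 : ℝ) (line 0)
    exact (ContinuousLinearMap.apply ℝ ℝ w).hasFDerivAt.comp_hasDerivAt (0 : ℝ) h2

/-- The entries of `exp (s X)` have the jets of `1 + s X + s² X² / 2`. -/
theorem exp_smul {n : Type*} [Fintype n] [DecidableEq n] (X : Matrix n n ℝ) (i j : n) :
    HasJetTwo (fun s : ℝ => NormedSpace.exp (s • X) i j)
      ((1 : Matrix n n ℝ) i j) (X i j) ((X * X) i j) := by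
  refine ⟨by simp, fun s => (NormedSpace.exp (s • X) * X) i j,
    .of_forall fun s => hasDerivAt_exp_smul_apply X i j s, by simp, ?_⟩
  have h := HasDerivAt.fun_sum (u := Finset.univ) fun k _ =>
    (hasDerivAt_exp_smul_apply X i k 0).mul_const (X k j)
  simpa only [zero_smul, NormedSpace.exp_zero, Matrix.one_mul, ← Matrix.mul_apply] using h

variable {n : Type*} [Fintype n]

theorem dotProduct {z z' : ℝ → n → ℝ} {z0 z1 z2 z0' z1' z2' : n → ℝ}
    (h : ∀ i, HasJetTwo (fun s => z s i) (z0 i) (z1 i) (z2 i))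
    (h' : ∀ i, HasJetTwo (fun s => z' s i) (z0' i) (z1' i) (z2' i)) :
    HasJetTwo (fun s => z s ⬝ᵥ z' s) (z0 ⬝ᵥ z0') (z1 ⬝ᵥ z0' + z0 ⬝ᵥ z1')
      (z2 ⬝ᵥ z0' + 2 * (z1 ⬝ᵥ z1') + z0 ⬝ᵥ z2') := by
  have := HasJetTwo.sum (s := Finset.univ) fun i _ => (h i).mul (h' i)
  simpa only [_root_.dotProduct, Finset.sum_add_distrib, Finset.mul_sum] using this

theorem mulVec {m : Type*} (D : Matrix m n ℝ) {z : ℝ → n → ℝ} {z0 z1 z2 : n → ℝ}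
    (h : ∀ i, HasJetTwo (fun s => z s i) (z0 i) (z1 i) (z2 i)) (i : m) :
    HasJetTwo (fun s => (D *ᵥ z s) i) ((D *ᵥ z0) i) ((D *ᵥ z1) i) ((D *ᵥ z2) i) := by
  have := HasJetTwo.sum (s := Finset.univ) fun j _ => (h j).const_mul (D i j)
  simpa only [Matrix.mulVec, _root_.dotProduct] using this

end HasJetTwo

/-! ### The ordered eigenvalues of a symmetric matrix -/

theorem eig_eq_eigenvalues₀ {A : Matrix (Fin 3) (Fin 3) ℝ} (hA : A.IsHermitian) (k : Fin 3) :
    eig A k = hA.eigenvalues₀ (Fin.cast (Fintype.card_fin 3).symm k) := by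
  rw [eig, dif_pos hA]

theorem eig_antitone {A : Matrix (Fin 3) (Fin 3) ℝ} (hA : A.IsHermitian) : Antitone (eig A) := by
  intro i k hik
  rw [eig_eq_eigenvalues₀ hA, eig_eq_eigenvalues₀ hA]
  exact hA.eigenvalues₀_antitone (show Fin.cast _ i ≤ Fin.cast _ k from hik)

/-- A symmetric matrix has an orthogonal matrix whose rows are eigenvectors, ordered as `eig`. -/
theorem exists_orthogonal_eig {A : Matrix (Fin 3) (Fin 3) ℝ} (hA : A.IsHermitian) :
    ∃ W : Matrix (Fin 3) (Fin 3) ℝ, W * Wᵀ = 1 ∧ ∀ k, A *ᵥ W k = eig A k • W k := by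
  classical
  let σ : Fin 3 ≃ Fin 3 := (finCongr (Fintype.card_fin 3).symm).trans
    (Fintype.equivOfCardEq (Fintype.card_fin _))
  refine ⟨fun k => ⇑(hA.eigenvectorBasis (σ k)), ?_, fun k => ?_⟩
  · ext i k
    have h := orthonormal_iff_ite.1 hA.eigenvectorBasis.orthonormal (σ k) (σ i)
    rw [EuclideanSpace.inner_eq_star_dotProduct] at h
    change ⇑(hA.eigenvectorBasis (σ i)) ⬝ᵥ ⇑(hA.eigenvectorBasis (σ k)) = _
    rw [Matrix.one_apply]
    simpa [eq_comm] using h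
  · have h := hA.mulVec_eigenvectorBasis (σ k)
    rw [eig_eq_eigenvalues₀ hA]
    simpa [IsHermitian.eigenvalues, σ] using h

theorem eig_congr_charpoly {A B : Matrix (Fin 3) (Fin 3) ℝ} (hA : A.IsHermitian)
    (hB : B.IsHermitian) (h : A.charpoly = B.charpoly) : eig A = eig B := by
  have h0 : hA.eigenvalues₀ = hB.eigenvalues₀ := by
    simp_rw [← List.ofFn_inj, ← IsHermitian.sort_roots_charpoly_eq_eigenvalues₀, h]
  funext k
  rw [eig_eq_eigenvalues₀ hA, eig_eq_eigenvalues₀ hB, h0]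

theorem eig_conj {A R : Matrix (Fin 3) (Fin 3) ℝ} (hA : A.IsHermitian) (hR : Rᵀ * R = 1) :
    eig (R * A * Rᵀ) = eig A := by
  have hB : (R * A * Rᵀ).IsHermitian := by
    simpa using isHermitian_mul_mul_conjTranspose R hA
  refine eig_congr_charpoly hB hA ?_
  rw [Matrix.charpoly_mul_comm, ← Matrix.mul_assoc, hR, Matrix.one_mul]

theorem det_sub_eig {A : Matrix (Fin 3) (Fin 3) ℝ} (hA : A.IsHermitian) (k : Fin 3) :
    (A - eig A k • (1 : Matrix (Fin 3) (Fin 3) ℝ)).det = 0 := by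
  obtain ⟨W, hW, hAW⟩ := exists_orthogonal_eig hA
  refine Matrix.exists_mulVec_eq_zero_iff.1 ⟨W k, fun h => ?_, ?_⟩
  · have := congrFun (congrFun hW k) k
    rw [Matrix.mul_apply'] at this
    simp [h] at this
  · rw [Matrix.sub_mulVec, hAW, Matrix.smul_mulVec, Matrix.one_mulVec, sub_self]

/-- The quadratic form of `A` in the coordinates of an orthonormal basis of eigenvectors. -/
theorem quadForm_eq_sum {A W : Matrix (Fin 3) (Fin 3) ℝ} {a : Fin 3 → ℝ} (hW : W * Wᵀ = 1)
    (hAW : ∀ k, A *ᵥ W k = a k • W k) (x : Fin 3 → ℝ) :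
    x ⬝ᵥ A *ᵥ x = ∑ k, a k * (W *ᵥ x) k ^ 2 := by
  have hW' : Wᵀ * W = 1 := mul_eq_one_comm.1 hW
  have h1 : A * Wᵀ = Wᵀ * diagonal a := by
    ext i k
    have := congrFun (hAW k) i
    rw [mul_diagonal]
    simpa [Matrix.mul_apply, Matrix.mulVec, dotProduct, mul_comm] using this
  have h2 : A = Wᵀ * diagonal a * W := by
    rw [← h1, Matrix.mul_assoc, hW', Matrix.mul_one]
  rw [h2, ← mulVec_mulVec, ← mulVec_mulVec, dotProduct_mulVec, vecMul_transpose]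
  simp only [dotProduct, mulVec_diagonal]
  exact Finset.sum_congr rfl fun k _ => by ring

theorem dotProduct_self_eq_sum {W : Matrix (Fin 3) (Fin 3) ℝ} (hW : W * Wᵀ = 1)
    (x : Fin 3 → ℝ) : x ⬝ᵥ x = ∑ k, (W *ᵥ x) k ^ 2 := by
  simpa using quadForm_eq_sum (A := 1) (a := fun _ => 1) hW (by simp) x

/-- Weyl's monotonicity inequality. The test vector is orthogonal to the eigenvectors of `A` of
index above `k` and to those of `B` of index below `k`: two conditions in dimension three. -/
theorem eig_le_add {A B : Matrix (Fin 3) (Fin 3) ℝ} (hA : A.IsHermitian) (hB : B.IsHermitian)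
    {ε : ℝ} (h : ∀ x, x ⬝ᵥ (A - B) *ᵥ x ≤ ε * (x ⬝ᵥ x)) (k : Fin 3) :
    eig A k ≤ eig B k + ε := by
  obtain ⟨U, hU, hAU⟩ := exists_orthogonal_eig hA
  obtain ⟨W, hW, hBW⟩ := exists_orthogonal_eig hB
  let Y : Matrix (Fin 3) (Fin 3) ℝ :=
    Matrix.of fun i => if i < k then W i else if k < i then U i else 0
  have hY : Y.det = 0 := Matrix.det_eq_zero_of_row_eq_zero k (by simp [Y])
  obtain ⟨x, hx0, hx⟩ := Matrix.exists_mulVec_eq_zero_iff.2 hY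
  have hx1 : ∀ i < k, (W *ᵥ x) i = 0 := fun i hi => by
    have := congrFun hx i
    simpa [Y, Matrix.mulVec, hi] using this
  have hx2 : ∀ i, k < i → (U *ᵥ x) i = 0 := fun i hi => by
    have := congrFun hx i
    simpa [Y, Matrix.mulVec, hi, hi.not_gt] using this
  have hpos : 0 < x ⬝ᵥ x := by
    refine lt_of_le_of_ne (Finset.sum_nonneg fun i _ => mul_self_nonneg _) fun h0 => hx0 ?_
    exact dotProduct_self_eq_zero.1 h0.symm
  have lower : eig A k * (x ⬝ᵥ x) ≤ x ⬝ᵥ A *ᵥ x := by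
    rw [quadForm_eq_sum hU hAU, dotProduct_self_eq_sum hU, Finset.mul_sum]
    refine Finset.sum_le_sum fun i _ => ?_
    rcases le_or_gt i k with hi | hi
    · exact mul_le_mul_of_nonneg_right (eig_antitone hA hi) (sq_nonneg _)
    · simp [hx2 i hi]
  have upper : x ⬝ᵥ B *ᵥ x ≤ eig B k * (x ⬝ᵥ x) := by
    rw [quadForm_eq_sum hW hBW, dotProduct_self_eq_sum hW, Finset.mul_sum]
    refine Finset.sum_le_sum fun i _ => ?_
    rcases le_or_gt k i with hi | hi
    · exact mul_le_mul_of_nonneg_right (eig_antitone hB hi) (sq_nonneg _)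
    · simp [hx1 i hi]
  have hd := h x
  rw [Matrix.sub_mulVec, dotProduct_sub] at hd
  nlinarith

/-- A crude bound of the quadratic form by the entries, enough for continuity. -/
theorem quadForm_le_of_abs_le {D : Matrix (Fin 3) (Fin 3) ℝ} {δ : ℝ} (hD : ∀ i j, |D i j| ≤ δ)
    (x : Fin 3 → ℝ) : x ⬝ᵥ D *ᵥ x ≤ 3 * δ * (x ⬝ᵥ x) := by
  have key : ∀ i j, x i * (D i j * x j) ≤ δ * ((x i ^ 2 + x j ^ 2) / 2) := by
    intro i j
    calc x i * (D i j * x j) ≤ |x i * (D i j * x j)| := le_abs_self _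
      _ = |D i j| * (|x i| * |x j|) := by rw [abs_mul, abs_mul]; ring
      _ ≤ δ * (|x i| * |x j|) := by gcongr; exact hD i j
      _ ≤ δ * ((x i ^ 2 + x j ^ 2) / 2) := by
        refine mul_le_mul_of_nonneg_left ?_ ((abs_nonneg _).trans (hD i j))
        nlinarith [sq_nonneg (|x i| - |x j|), sq_abs (x i), sq_abs (x j)]
  have := Finset.sum_le_sum fun i (_ : i ∈ Finset.univ) =>
    Finset.sum_le_sum fun j (_ : j ∈ Finset.univ) => key i j
  simp only [dotProduct, Matrix.mulVec, Finset.mul_sum]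
  refine this.trans (le_of_eq ?_)
  simp only [Fin.sum_univ_three]
  ring

/-- The ordered eigenvalues depend continuously on a symmetric matrix. -/
theorem continuousAt_eig {E : Type*} [TopologicalSpace E] {A : E → Matrix (Fin 3) (Fin 3) ℝ}
    {e : E} (hA : ∀ d, (A d).IsHermitian) (hc : ContinuousAt A e) (k : Fin 3) :
    ContinuousAt (fun d => eig (A d) k) e := by
  rw [ContinuousAt, Metric.tendsto_nhds]
  intro ε hε
  have hclose : ∀ᶠ d in 𝓝 e, ∀ i j, |A d i j - A e i j| ≤ ε / 6 := by
    refine Filter.eventually_all.2 fun i => Filter.eventually_all.2 fun j => ?_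
    have hij : ContinuousAt (fun d => A d i j) e :=
      continuousAt_pi.1 (continuousAt_pi.1 hc i) j
    filter_upwards [Metric.tendsto_nhds.1 hij (ε / 6) (by positivity)] with d hd
    exact (Real.dist_eq _ _ ▸ hd).le
  filter_upwards [hclose] with d hd
  have h1 : eig (A d) k ≤ eig (A e) k + 3 * (ε / 6) :=
    eig_le_add (hA d) (hA e) (quadForm_le_of_abs_le fun i j => by simpa using hd i j) k
  have h2 : eig (A e) k ≤ eig (A d) k + 3 * (ε / 6) :=
    eig_le_add (hA e) (hA d)
      (quadForm_le_of_abs_le fun i j => by simpa [abs_sub_comm] using hd i j) k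
  rw [Real.dist_eq, abs_lt]
  constructor <;> linarith

/-! ### The perturbed covariance in homogeneous coordinates -/

/-- The homogeneous vector `(x, 0)` of a direction `x`. -/
def hom (x : Fin 3 → ℝ) : I4 → ℝ := Sum.elim x 0

/-- The last standard basis vector `(0, 1)` of homogeneous coordinates. -/
def last : I4 → ℝ := Sum.elim 0 1

/-- The homogeneous matrix of the rigid motion `(exp ⌊φ⌋, τ)`, for `d = (φ, τ)`. -/
noncomputable def motion (d : I6 → ℝ) : Matrix I4 I4 ℝ :=
  fromBlocks (expRot fun i => d (Sum.inl i)).1 (replicateCol (Fin 1) fun i => d (Sum.inr i)) 0 1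

/-- The summand `T_q C_q T_qᵀ` of the merged matrix. -/
def moved {M : ℕ} (C : Fin M → Matrix I4 I4 ℝ) (T : Fin M → SE3) (q : Fin M) : Matrix I4 I4 ℝ :=
  (T q).mat * C q * (T q).matᵀ

theorem boxplus_mat (T : SE3) (d : I6 → ℝ) : (T.boxplus d).mat = motion d * T.mat := by
  simp only [SE3.mat, motion, SE3.boxplus, fromBlocks_multiply]
  congr 1 <;> ext i j <;> simp [Matrix.mul_apply, Matrix.mulVec, dotProduct, add_comm]

theorem merged_boxplus {M : ℕ} (C : Fin M → Matrix I4 I4 ℝ) (T : Fin M → SE3) (d : Idx M → ℝ) :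
    merged C (boxplus T d) =
      ∑ j, motion (fun a => d (j, a)) * moved C T j * (motion fun a => d (j, a))ᵀ := by
  refine Finset.sum_congr rfl fun j _ => ?_
  simp only [boxplus, boxplus_mat, moved, transpose_mul, Matrix.mul_assoc]

theorem countN_eq (C : Matrix I4 I4 ℝ) : countN C = last ⬝ᵥ C *ᵥ last := by
  simp [countN, last, dotProduct, Matrix.mulVec]

theorem dotProduct_covA_mulVec (C : Matrix I4 I4 ℝ) (x y : Fin 3 → ℝ) :
    x ⬝ᵥ covA C *ᵥ y = 1 / countN C * (hom x ⬝ᵥ C *ᵥ hom y) -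
      1 / countN C ^ 2 * ((hom x ⬝ᵥ C *ᵥ last) * (hom y ⬝ᵥ C *ᵥ last)) := by
  have hxy : hom x ⬝ᵥ C *ᵥ hom y = x ⬝ᵥ C.toBlocks₁₁ *ᵥ y := by
    simp [hom, dotProduct, Matrix.mulVec, toBlocks₁₁]
  have hx : ∀ x, hom x ⬝ᵥ C *ᵥ last = x ⬝ᵥ sumV C := fun x => by
    simp [hom, last, dotProduct, Matrix.mulVec, sumV]
  rw [hxy, hx, hx, covA, sub_mulVec, smul_mulVec, smul_mulVec, dotProduct_sub, dotProduct_smul,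
    dotProduct_smul, vecMulVec_mulVec]
  simp [dotProduct_comm y, mul_comm]

theorem motion_transpose_mulVec_last (d : I6 → ℝ) : (motion d)ᵀ *ᵥ last = last := by
  ext (i | i) <;> simp [motion, last, Matrix.mulVec, dotProduct, Fin.fin_one_eq_zero]

theorem motion_transpose_mulVec_hom (d : I6 → ℝ) (x : Fin 3 → ℝ) :
    (motion d)ᵀ *ᵥ hom x =
      Sum.elim ((expRot fun i => d (Sum.inl i)).1ᵀ *ᵥ x) fun _ => (fun i => d (Sum.inr i)) ⬝ᵥ x := by
  ext (i | i) <;> simp [motion, hom, Matrix.mulVec, dotProduct]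

theorem dotProduct_merged_boxplus_mulVec {M : ℕ} (C : Fin M → Matrix I4 I4 ℝ) (T : Fin M → SE3)
    (d : Idx M → ℝ) (x y : I4 → ℝ) :
    x ⬝ᵥ merged C (boxplus T d) *ᵥ y =
      ∑ j, ((motion fun a => d (j, a))ᵀ *ᵥ x) ⬝ᵥ
        moved C T j *ᵥ ((motion fun a => d (j, a))ᵀ *ᵥ y) := by
  rw [merged_boxplus, sum_mulVec, dotProduct_sum]
  refine Finset.sum_congr rfl fun j _ => ?_
  rw [← mulVec_mulVec, ← mulVec_mulVec, dotProduct_mulVec, ← mulVec_transpose]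

theorem dotProduct_merged_mulVec {M : ℕ} (C : Fin M → Matrix I4 I4 ℝ) (T : Fin M → SE3)
    (x y : I4 → ℝ) : x ⬝ᵥ merged C T *ᵥ y = ∑ j, x ⬝ᵥ moved C T j *ᵥ y := by
  rw [← dotProduct_sum, ← sum_mulVec]
  rfl

/-- The perturbation does not change the lower right entry of the merged matrix. -/
theorem countN_merged_boxplus {M : ℕ} (C : Fin M → Matrix I4 I4 ℝ) (T : Fin M → SE3)
    (d : Idx M → ℝ) : countN (merged C (boxplus T d)) = countN (merged C T) := by
  simp only [countN_eq, dotProduct_merged_boxplus_mulVec, motion_transpose_mulVec_last]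
  exact (dotProduct_merged_mulVec C T last last).symm

theorem skew_smul (s : ℝ) (a : Fin 3 → ℝ) : skew (s • a) = s • skew a := by
  ext i j
  fin_cases i <;> fin_cases j <;> simp [skew]

theorem skew_zero : skew 0 = 0 := by
  simpa using skew_smul 0 0

theorem skew_mulVec_swap (a b : Fin 3 → ℝ) : skew a *ᵥ b = -(skew b *ᵥ a) := by
  ext i
  fin_cases i <;> simp [skew, Matrix.mulVec, dotProduct, Fin.sum_univ_three] <;> ring

/-- The jet along a line of a direction pulled back by the perturbing motion; its first-order part
is what the matrix `UU x` encodes. -/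
theorem hasJetTwo_motion (x : Fin 3 → ℝ) (w : I6 → ℝ) (a : I4) :
    HasJetTwo (fun s : ℝ => ((motion (s • w))ᵀ *ᵥ hom x) a) (hom x a) (((UU x)ᵀ *ᵥ w) a)
      (hom (skew (fun i => w (Sum.inl i)) *ᵥ skew (fun i => w (Sum.inl i)) *ᵥ x) a) := by
  set φ : Fin 3 → ℝ := fun i => w (Sum.inl i) with hφ
  rcases a with i | i
  · have h := HasJetTwo.sum (s := Finset.univ) fun k _ =>
      (HasJetTwo.exp_smul (skew φ) k i).const_mul (x k)
    have e0 : ∑ k, x k * (1 : Matrix (Fin 3) (Fin 3) ℝ) k i = hom x (Sum.inl i) := by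
      simp [hom, Matrix.one_apply]
    have e1 : ∑ k, x k * skew φ k i = ((UU x)ᵀ *ᵥ w) (Sum.inl i) := by
      have h1 : ((UU x)ᵀ *ᵥ w) (Sum.inl i) = (skew x *ᵥ φ) i := by
        rw [UU, fromBlocks_transpose, transpose_neg, skew_transpose, neg_neg]
        simp [Matrix.mulVec, dotProduct, hφ]
      rw [h1, skew_mulVec_swap, ← neg_mulVec, ← skew_transpose]
      simp [Matrix.mulVec, dotProduct, mul_comm]
    have e2 : ∑ k, x k * (skew φ * skew φ) k i = hom (skew φ *ᵥ skew φ *ᵥ x) (Sum.inl i) := by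
      have h2 : (skew φ * skew φ)ᵀ = skew φ * skew φ := by
        rw [transpose_mul, skew_transpose, neg_mul_neg]
      rw [mulVec_mulVec]
      simp only [hom, Sum.elim_inl, Matrix.mulVec, dotProduct]
      refine Finset.sum_congr rfl fun k _ => ?_
      rw [← congrFun (congrFun h2 i) k, transpose_apply, mul_comm]
    rw [e0, e1, e2] at h
    refine h.congr_of_eventuallyEq (.of_forall fun s => ?_)
    have hs : (expRot fun i => (s • w) (Sum.inl i)).1 = NormedSpace.exp (s • skew φ) := by
      rw [← skew_smul]
      rfl
    simp only [motion_transpose_mulVec_hom, hs]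
    simp only [Sum.elim_inl, Matrix.mulVec, dotProduct, transpose_apply, mul_comm]
  · have h := HasJetTwo.id_mul (∑ k, x k * w (Sum.inr k))
    have e1 : ∑ k, x k * w (Sum.inr k) = ((UU x)ᵀ *ᵥ w) (Sum.inr i) := by
      simp [UU, Matrix.mulVec, dotProduct]
    rw [e1] at h
    refine HasJetTwo.congr_of_eventuallyEq h (.of_forall fun s => ?_)
    simp only [motion_transpose_mulVec_hom, Sum.elim_inr, dotProduct, ← e1, Finset.mul_sum,
      Pi.smul_apply, smul_eq_mul, mul_comm, mul_left_comm]

section Jets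

variable {M : ℕ} (C : Fin M → Matrix I4 I4 ℝ) (T : Fin M → SE3)

/-- The jet of an entry `xᵀ A y` along a line, by the product rule. Here `δ x j` and `ω x j` are the
first and second derivatives of the direction `x` pulled back by the motion of the pose `j`. -/
theorem hasJetTwo_covA (x y : Fin 3 → ℝ) (w : Idx M → ℝ) :
    let N := countN (merged C T)
    let D := moved C T
    let δ : (Fin 3 → ℝ) → Fin M → I4 → ℝ := fun x j => (UU x)ᵀ *ᵥ fun a => w (j, a)
    let ω : (Fin 3 → ℝ) → Fin M → I4 → ℝ := fun x j =>
      hom (skew (fun i => w (j, Sum.inl i)) *ᵥ skew (fun i => w (j, Sum.inl i)) *ᵥ x)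
    HasJetTwo (fun s : ℝ => x ⬝ᵥ covA (merged C (boxplus T (s • w))) *ᵥ y)
      (x ⬝ᵥ covA (merged C T) *ᵥ y)
      (1 / N * ∑ j, (δ x j ⬝ᵥ D j *ᵥ hom y + hom x ⬝ᵥ D j *ᵥ δ y j) -
        1 / N ^ 2 * ((∑ j, δ x j ⬝ᵥ D j *ᵥ last) * (hom y ⬝ᵥ merged C T *ᵥ last) +
          (hom x ⬝ᵥ merged C T *ᵥ last) * ∑ j, δ y j ⬝ᵥ D j *ᵥ last))
      (1 / N * ∑ j, (ω x j ⬝ᵥ D j *ᵥ hom y + 2 * (δ x j ⬝ᵥ D j *ᵥ δ y j) +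
          hom x ⬝ᵥ D j *ᵥ ω y j) -
        1 / N ^ 2 * ((∑ j, ω x j ⬝ᵥ D j *ᵥ last) * (hom y ⬝ᵥ merged C T *ᵥ last) +
          2 * ((∑ j, δ x j ⬝ᵥ D j *ᵥ last) * ∑ j, δ y j ⬝ᵥ D j *ᵥ last) +
          (hom x ⬝ᵥ merged C T *ᵥ last) * ∑ j, ω y j ⬝ᵥ D j *ᵥ last)) := by
  intro N D δ ω
  have hz : ∀ x j a, HasJetTwo
      (fun s : ℝ => ((motion fun a => (s • w) (j, a))ᵀ *ᵥ hom x) a) (hom x a) (δ x j a) (ω x j a) :=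
    fun x j a => hasJetTwo_motion x (fun a => w (j, a)) a
  have hP := HasJetTwo.sum (s := Finset.univ) fun j _ =>
    (HasJetTwo.dotProduct (hz x j) (HasJetTwo.mulVec (D j) (hz y j)))
  have hv : ∀ x, HasJetTwo _ _ _ _ := fun x => HasJetTwo.sum (s := Finset.univ) fun j _ =>
    (HasJetTwo.dotProduct (hz x j) fun a => HasJetTwo.const ((D j *ᵥ last) a))
  have h := (hP.const_mul (1 / N)).sub (((hv x).mul (hv y)).const_mul (1 / N ^ 2))
  have z0 : ∀ v : I4 → ℝ, (v ⬝ᵥ fun _ => (0 : ℝ)) = 0 := fun v => dotProduct_zero v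
  simp only [z0, mul_zero, add_zero] at h
  simp only [dotProduct_covA_mulVec, countN_merged_boxplus, dotProduct_merged_boxplus_mulVec,
    motion_transpose_mulVec_last]
  simp only [dotProduct_merged_mulVec]
  exact h

end Jets

/-! ### The formulas for the gradient and the Hessian of the entries of `A` -/

section Formulas

variable {M : ℕ} (C : Fin M → Matrix I4 I4 ℝ) (T : Fin M → SE3)

theorem dotProduct_SP_mulVec (x : Fin 3 → ℝ) (v : I4 → ℝ) : x ⬝ᵥ SP *ᵥ v = hom x ⬝ᵥ v := by
  simp [SP, hom, dotProduct, Matrix.mulVec, Matrix.one_apply]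

theorem SP_transpose_mulVec (x : Fin 3 → ℝ) : SPᵀ *ᵥ x = hom x := by
  ext (i | i) <;> simp [SP, hom, dotProduct, Matrix.mulVec, Matrix.one_apply]

theorem FF_eq : FF = vecMulVec last last := by
  ext (i | i) (j | j) <;> simp [FF, last, vecMulVec_apply, Fin.fin_one_eq_zero]

theorem FF_mul_mat (P : SE3) : FF * P.mat = FF := by
  simp [FF, SE3.mat, fromBlocks_multiply]

theorem FF_mul_moved (q : Fin M) : FF * moved C T q = FF * C q * (T q).matᵀ := by
  rw [moved, ← Matrix.mul_assoc, ← Matrix.mul_assoc, FF_mul_mat]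

theorem moved_isSymm (hC : ∀ j, (C j).IsSymm) (q : Fin M) : (moved C T q)ᵀ = moved C T q := by
  rw [moved, transpose_mul, transpose_mul, transpose_transpose, (hC q).eq, Matrix.mul_assoc]

theorem dotProduct_moved_comm (hC : ∀ j, (C j).IsSymm) (q : Fin M) (x y : I4 → ℝ) :
    x ⬝ᵥ moved C T q *ᵥ y = y ⬝ᵥ moved C T q *ᵥ x := by
  rw [dotProduct_mulVec, ← mulVec_transpose, moved_isSymm C T hC, dotProduct_comm]

theorem centered_mul (q : Fin M) :
    centered C T q * C q * (T q).matᵀ =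
      moved C T q - (1 / countN (merged C T)) • (merged C T * FF * moved C T q) := by
  rw [Matrix.mul_assoc (merged C T), FF_mul_moved, centered, Matrix.sub_mul, Matrix.sub_mul,
    Matrix.smul_mul, Matrix.smul_mul]
  simp only [moved, Matrix.mul_assoc]

/-- Centring subtracts the mean `v / N` of the merged point cloud. -/
theorem dotProduct_centered_mulVec (q : Fin M) (x : Fin 3 → ℝ) (v : I4 → ℝ) :
    x ⬝ᵥ (SP * centered C T q * C q * (T q).matᵀ) *ᵥ v =
      hom x ⬝ᵥ moved C T q *ᵥ v - 1 / countN (merged C T) *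
        ((hom x ⬝ᵥ merged C T *ᵥ last) * (last ⬝ᵥ moved C T q *ᵥ v)) := by
  rw [Matrix.mul_assoc SP, Matrix.mul_assoc SP, centered_mul, ← mulVec_mulVec,
    dotProduct_SP_mulVec, sub_mulVec, dotProduct_sub, smul_mulVec, dotProduct_smul, smul_eq_mul,
    ← mulVec_mulVec, ← mulVec_mulVec, FF_eq, vecMulVec_mulVec]
  simp [mulVec_smul, mul_comm]

theorem gBlock_dotProduct (x y : Fin 3 → ℝ) (q : Fin M) (w : I6 → ℝ) :
    gBlock C T x y q ⬝ᵥ w =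
      1 / countN (merged C T) * (y ⬝ᵥ (SP * centered C T q * C q * (T q).matᵀ) *ᵥ (UU x)ᵀ *ᵥ w) +
      1 / countN (merged C T) *
        (x ⬝ᵥ (SP * centered C T q * C q * (T q).matᵀ) *ᵥ (UU y)ᵀ *ᵥ w) := by
  rw [gBlock, add_dotProduct, smul_dotProduct, smul_dotProduct, ← dotProduct_mulVec,
    ← dotProduct_mulVec, mulVec_mulVec, mulVec_mulVec, smul_eq_mul, smul_eq_mul]

theorem gRow_dotProduct (x y : Fin 3 → ℝ) (w : Idx M → ℝ) :
    gRow C T x y ⬝ᵥ w = ∑ q, gBlock C T x y q ⬝ᵥ fun a => w (q, a) := by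
  simp only [dotProduct, gRow, Fintype.sum_prod_type]

theorem dotProduct_HMat (x : Fin 3 → ℝ) (w : Idx M → ℝ) :
    w ⬝ᵥ HMat C T x *ᵥ w =
      ∑ p, ∑ q, (fun a => w (p, a)) ⬝ᵥ HBlock C T x p q *ᵥ fun a => w (q, a) := by
  simp only [dotProduct, Matrix.mulVec, HMat, Fintype.sum_prod_type (f := fun i : Idx M => _),
    Matrix.of_apply, Finset.mul_sum]
  exact Finset.sum_congr rfl fun p _ => Finset.sum_comm

/-- The quadratic form of `K^q`, expressed by the second derivative `⌊φ⌋² x` of the rotated `x`. -/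
theorem dotProduct_skew_skew (φ a x : Fin 3 → ℝ) :
    φ ⬝ᵥ (skew a * skew x + skew x * skew a) *ᵥ φ = 2 * ((skew φ *ᵥ skew φ *ᵥ x) ⬝ᵥ a) := by
  simp only [skew, dotProduct, Matrix.mulVec, Fin.sum_univ_three]
  simp
  ring

/-- The vector `a_q` of the block `K^q`, tested against `y`. -/
theorem dotProduct_KBlock_vec (hC : ∀ j, (C j).IsSymm) (q : Fin M) (x y : Fin 3 → ℝ) :
    y ⬝ᵥ (SP * (T q).mat * C q * (centered C T q)ᵀ * SPᵀ) *ᵥ x =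
      hom y ⬝ᵥ moved C T q *ᵥ hom x - 1 / countN (merged C T) *
        ((hom x ⬝ᵥ merged C T *ᵥ last) * (hom y ⬝ᵥ moved C T q *ᵥ last)) := by
  have h : SP * (T q).mat * C q * (centered C T q)ᵀ * SPᵀ =
      (SP * centered C T q * C q * (T q).matᵀ * SPᵀ)ᵀ := by
    simp only [transpose_mul, transpose_transpose, (hC q).eq, Matrix.mul_assoc]
  rw [h, mulVec_transpose, dotProduct_comm, ← dotProduct_mulVec, ← mulVec_mulVec,
    SP_transpose_mulVec, dotProduct_centered_mulVec, dotProduct_moved_comm C T hC q (hom x),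
    dotProduct_moved_comm C T hC q last]

theorem dotProduct_KBlock (hC : ∀ j, (C j).IsSymm) (q : Fin M) (x φ : Fin 3 → ℝ) :
    φ ⬝ᵥ KBlock C T x q *ᵥ φ = 2 / countN (merged C T) *
      (hom (skew φ *ᵥ skew φ *ᵥ x) ⬝ᵥ moved C T q *ᵥ hom x - 1 / countN (merged C T) *
        ((hom x ⬝ᵥ merged C T *ᵥ last) *
          (hom (skew φ *ᵥ skew φ *ᵥ x) ⬝ᵥ moved C T q *ᵥ last))) := by
  rw [KBlock, ← smul_add, smul_mulVec, dotProduct_smul, dotProduct_skew_skew,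
    dotProduct_KBlock_vec C T hC, smul_eq_mul]
  ring

/-- `C_p F C_q` may be moved by the poses, because `F T_p = F`. -/
theorem mat_mul_DD (p q : Fin M) :
    (T p).mat * DD C p q * (T q).matᵀ = moved C T p * FF * moved C T q := by
  have hF : FFᵀ = FF := by rw [FF_eq, transpose_vecMulVec]
  have h : (T p).matᵀ * FF = FF := by
    rw [← hF, ← transpose_mul, FF_mul_mat]
  rw [Matrix.mul_assoc (moved C T p), FF_mul_moved, moved, DD, Matrix.mul_assoc _ (T p).matᵀ,
    ← Matrix.mul_assoc (T p).matᵀ, ← Matrix.mul_assoc (T p).matᵀ, h]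
  simp only [Matrix.mul_assoc]

theorem dotProduct_mul_mul_transpose {m n : Type*} [Fintype m] [Fintype n] (U : Matrix m n ℝ)
    (D : Matrix n n ℝ) (w w' : m → ℝ) :
    w ⬝ᵥ (U * D * Uᵀ) *ᵥ w' = (Uᵀ *ᵥ w) ⬝ᵥ D *ᵥ (Uᵀ *ᵥ w') := by
  rw [← mulVec_mulVec, ← mulVec_mulVec, dotProduct_mulVec, mulVec_transpose U w]

theorem dotProduct_HBlock (hC : ∀ j, (C j).IsSymm) (x : Fin 3 → ℝ) (p q : Fin M)
    (w w' : I6 → ℝ) :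
    w ⬝ᵥ HBlock C T x p q *ᵥ w' =
      -(2 / countN (merged C T) ^ 2) * ((((UU x)ᵀ *ᵥ w) ⬝ᵥ moved C T p *ᵥ last) *
        (((UU x)ᵀ *ᵥ w') ⬝ᵥ moved C T q *ᵥ last)) +
      if p = q then 2 / countN (merged C T) *
        (((UU x)ᵀ *ᵥ w) ⬝ᵥ moved C T q *ᵥ ((UU x)ᵀ *ᵥ w')) +
        (fun i => w (Sum.inl i)) ⬝ᵥ KBlock C T x q *ᵥ fun i => w' (Sum.inl i) else 0 := by
  have h1 : UU x * (T p).mat * DD C p q * (T q).matᵀ * (UU x)ᵀ =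
      UU x * (moved C T p * FF * moved C T q) * (UU x)ᵀ := by
    rw [← mat_mul_DD]
    simp only [Matrix.mul_assoc]
  have h2 : UU x * (T q).mat * C q * (T q).matᵀ * (UU x)ᵀ =
      UU x * moved C T q * (UU x)ᵀ := by
    simp only [moved, Matrix.mul_assoc]
  have h3 : w ⬝ᵥ fromBlocks (KBlock C T x q) 0 0 (0 : Matrix (Fin 3) (Fin 3) ℝ) *ᵥ w' =
      (fun i => w (Sum.inl i)) ⬝ᵥ KBlock C T x q *ᵥ fun i => w' (Sum.inl i) := by
    simp [dotProduct, Matrix.mulVec]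
  rw [HBlock, h1, h2, add_mulVec, dotProduct_add, smul_mulVec, dotProduct_smul,
    dotProduct_mul_mul_transpose, ← mulVec_mulVec, ← mulVec_mulVec, FF_eq, vecMulVec_mulVec,
    smul_eq_mul]
  congr 1
  · simp only [op_smul_eq_smul, mulVec_smul, dotProduct_smul, smul_eq_mul]
    rw [dotProduct_moved_comm C T hC q last]
    ring
  · split_ifs
    · rw [add_mulVec, dotProduct_add, smul_mulVec, dotProduct_smul, dotProduct_mul_mul_transpose,
        h3, smul_eq_mul]
    · simp

/-- Along a line, `gRow` is the first derivative of an entry `xᵀ A y`. -/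
theorem exists_hasJetTwo_covA (hC : ∀ j, (C j).IsSymm) (x y : Fin 3 → ℝ) (w : Idx M → ℝ) :
    ∃ c, HasJetTwo (fun s : ℝ => x ⬝ᵥ covA (merged C (boxplus T (s • w))) *ᵥ y)
      (x ⬝ᵥ covA (merged C T) *ᵥ y) (gRow C T x y ⬝ᵥ w) c := by
  obtain ⟨h0, f', h1, h2, h3⟩ := hasJetTwo_covA C T x y w
  refine ⟨_, h0, f', h1, h2.trans ?_, h3⟩
  rw [gRow_dotProduct]
  simp only [gBlock_dotProduct, dotProduct_centered_mulVec,
    dotProduct_moved_comm C T hC _ _ (hom y), dotProduct_moved_comm C T hC _ last,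
    Finset.sum_add_distrib, ← Finset.mul_sum, Finset.sum_sub_distrib]
  ring

/-- Along a line, `HMat` is the second derivative of a diagonal entry `xᵀ A x`. -/
theorem hasJetTwo_covA_self (hC : ∀ j, (C j).IsSymm) (x : Fin 3 → ℝ) (w : Idx M → ℝ) :
    HasJetTwo (fun s : ℝ => x ⬝ᵥ covA (merged C (boxplus T (s • w))) *ᵥ x)
      (x ⬝ᵥ covA (merged C T) *ᵥ x) (gRow C T x x ⬝ᵥ w) (w ⬝ᵥ HMat C T x *ᵥ w) := by
  obtain ⟨c, hc⟩ := exists_hasJetTwo_covA C T hC x x w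
  have hraw := hasJetTwo_covA C T x x w
  have hcc := (hc.unique hraw).2.2
  suffices w ⬝ᵥ HMat C T x *ᵥ w = c by rwa [this]
  rw [hcc, dotProduct_HMat]
  simp only [dotProduct_HBlock C T hC, dotProduct_KBlock C T hC, Finset.sum_add_distrib,
    Finset.sum_ite_eq, Finset.mem_univ, if_true, ← Finset.mul_sum, ← Finset.sum_mul,
    Finset.sum_sub_distrib, dotProduct_moved_comm C T hC _ (hom x)]
  ring

theorem KBlock_transpose (x : Fin 3 → ℝ) (q : Fin M) : (KBlock C T x q)ᵀ = KBlock C T x q := by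
  simp only [KBlock, transpose_add, transpose_smul, transpose_mul, skew_transpose, neg_mul_neg]
  exact add_comm _ _

theorem HBlock_transpose (hC : ∀ j, (C j).IsSymm) (x : Fin 3 → ℝ) (p q : Fin M) :
    (HBlock C T x p q)ᵀ = HBlock C T x q p := by
  have hF : FFᵀ = FF := by rw [FF_eq, transpose_vecMulVec]
  rw [HBlock, HBlock, transpose_add]
  congr 1
  · simp only [transpose_smul, transpose_mul, transpose_transpose, DD, (hC _).eq, hF,
      Matrix.mul_assoc]
  · by_cases h : p = q
    · subst h
      simp only [if_true, transpose_add, transpose_smul, transpose_mul, transpose_transpose,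
        (hC _).eq, Matrix.mul_assoc, fromBlocks_transpose, KBlock_transpose, transpose_zero]
    · rw [if_neg h, if_neg (Ne.symm h), transpose_zero]

theorem HMat_transpose (hC : ∀ j, (C j).IsSymm) (x : Fin 3 → ℝ) :
    (HMat C T x)ᵀ = HMat C T x := by
  ext i j
  exact congrFun (congrFun (HBlock_transpose C T hC x j.1 i.1) i.2) j.2

theorem gRow_eq_zero {p : Fin M} (hp : C p = 0) (x y : Fin 3 → ℝ) (a : I6) :
    gRow C T x y (p, a) = 0 := by
  simp [gRow, gBlock, hp]

theorem HMat_eq_zero {p q : Fin M} (h : C p = 0 ∨ C q = 0) (x : Fin 3 → ℝ) (a b : I6) :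
    HMat C T x (p, a) (q, b) = 0 := by
  have hDD : DD C p q = 0 := by rcases h with h | h <;> simp [DD, h]
  by_cases hpq : p = q
  · subst hpq
    have hp : C p = 0 := h.elim id id
    simp [HMat, HBlock, hDD, hp, KBlock, skew_zero]
  · simp [HMat, HBlock, hDD, hpq]

end Formulas

/-! ### Smoothness of a simple eigenvalue -/

theorem mul_mul_transpose_apply (U A : Matrix (Fin 3) (Fin 3) ℝ) (i k : Fin 3) :
    (U * A * Uᵀ) i k = U i ⬝ᵥ A *ᵥ U k := by
  rw [Matrix.mul_assoc, Matrix.mul_apply']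
  congr 1

theorem det_mul_mul_transpose {U : Matrix (Fin 3) (Fin 3) ℝ} (hU : U * Uᵀ = 1)
    (A : Matrix (Fin 3) (Fin 3) ℝ) : (U * A * Uᵀ).det = A.det := by
  rw [det_mul_right_comm, hU, Matrix.one_mul]

/-- The matrix `A - x` in the basis of the rows of `U`. -/
def shifted (U A : Matrix (Fin 3) (Fin 3) ℝ) (x : ℝ) : Matrix (Fin 3) (Fin 3) ℝ :=
  Matrix.of fun i k => U i ⬝ᵥ A *ᵥ U k - x * (1 : Matrix (Fin 3) (Fin 3) ℝ) i k

theorem shifted_eq {U : Matrix (Fin 3) (Fin 3) ℝ} (hU : U * Uᵀ = 1)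
    (A : Matrix (Fin 3) (Fin 3) ℝ) (x : ℝ) :
    shifted U A x = U * (A - x • (1 : Matrix (Fin 3) (Fin 3) ℝ)) * Uᵀ := by
  rw [Matrix.mul_sub, Matrix.sub_mul, Matrix.mul_smul, Matrix.smul_mul, Matrix.mul_one, hU]
  ext i k
  simp [shifted, mul_mul_transpose_apply]

theorem det_shifted_eig {U A : Matrix (Fin 3) (Fin 3) ℝ} (hU : U * Uᵀ = 1) (hA : A.IsHermitian)
    (l : Fin 3) : (shifted U A (eig A l)).det = 0 := by
  rw [shifted_eq hU, det_mul_mul_transpose hU, det_sub_eig hA]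

theorem shifted_eigenbasis {U A : Matrix (Fin 3) (Fin 3) ℝ} {a : Fin 3 → ℝ} (hU : U * Uᵀ = 1)
    (hAU : ∀ k, A *ᵥ U k = a k • U k) (x : ℝ) : shifted U A x = diagonal fun k => a k - x := by
  ext i k
  have h : U i ⬝ᵥ U k = (1 : Matrix (Fin 3) (Fin 3) ℝ) i k := by
    rw [← hU, Matrix.mul_apply']
    rfl
  rw [shifted, Matrix.of_apply, hAU, dotProduct_smul, h, Matrix.one_apply, diagonal_apply]
  split_ifs with hik
  · simp [hik]
  · simp

theorem isInvertible_of_apply_one_ne_zero {L : ℝ →L[ℝ] ℝ} (h : L 1 ≠ 0) :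
    L.IsInvertible := by
  refine ⟨ContinuousLinearEquiv.unitsEquivAut ℝ (Units.mk0 _ h), ?_⟩
  ext
  simp

/-- A simple eigenvalue of a `C²` family of symmetric matrices is `C²`: the implicit function
theorem applies to the characteristic equation, and by continuity the ordered eigenvalue is the
implicit function. -/
theorem contDiffAt_eig {E : Type*} [NormedAddCommGroup E] [NormedSpace ℝ E] [CompleteSpace E]
    {A : E → Matrix (Fin 3) (Fin 3) ℝ} (hA : ∀ d, (A d).IsHermitian)
    (hs : ∀ x y, ContDiff ℝ 2 fun d => x ⬝ᵥ A d *ᵥ y) {U : Matrix (Fin 3) (Fin 3) ℝ}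
    (hU : U * Uᵀ = 1) (e : E) (hAU : ∀ k, A e *ᵥ U k = eig (A e) k • U k) (l : Fin 3)
    (hl : ∀ k, k ≠ l → eig (A e) k ≠ eig (A e) l) :
    ContDiffAt ℝ 2 (fun d => eig (A d) l) e := by
  set lam := eig (A e) l with hlam
  let Φ : E × ℝ → ℝ := fun p => (shifted U (A p.1) p.2).det
  have hΦ : ContDiff ℝ 2 Φ := by
    have hent : ∀ i k, ContDiff ℝ 2 fun p : E × ℝ => shifted U (A p.1) p.2 i k := fun i k =>
      ((hs (U i) (U k)).comp contDiff_fst).sub (contDiff_snd.mul contDiff_const)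
    simp only [Φ, det_fin_three]
    fun_prop
  have hc : ContDiffAt ℝ 2 Φ (e, lam) := hΦ.contDiffAt
  have hΦ0 : Φ (e, lam) = 0 := det_shifted_eig hU (hA e) l
  have hderiv : fderiv ℝ Φ (e, lam) (0, 1) =
      -∏ k ∈ Finset.univ.erase l, (eig (A e) k - lam) := by
    have h1 : HasDerivAt (fun x : ℝ => Φ (e, x)) (fderiv ℝ Φ (e, lam) (0, 1)) lam :=
      (hc.differentiableAt (by simp)).hasFDerivAt.comp_hasDerivAt lam
        ((hasDerivAt_const lam e).prodMk (hasDerivAt_id lam))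
    have h2 : (fun x : ℝ => Φ (e, x)) = fun x =>
        (lam - x) * ∏ k ∈ Finset.univ.erase l, (eig (A e) k - x) := by
      funext x
      simp only [Φ]
      rw [shifted_eigenbasis hU hAU, det_diagonal, ← Finset.mul_prod_erase _ _ (Finset.mem_univ l)]
    rw [h2] at h1
    have h3 : DifferentiableAt ℝ
        (fun x : ℝ => ∏ k ∈ Finset.univ.erase l, (eig (A e) k - x)) lam := by fun_prop
    have h4 := ((hasDerivAt_id lam).const_sub lam).mul h3.hasDerivAt
    rw [h1.unique h4]
    simp
  have hinv : (fderiv ℝ Φ (e, lam) ∘L .inr ℝ E ℝ).IsInvertible := by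
    refine isInvertible_of_apply_one_ne_zero ?_
    simp only [ContinuousLinearMap.comp_apply, ContinuousLinearMap.inr_apply, hderiv]
    refine neg_ne_zero.2 (Finset.prod_ne_zero_iff.2 fun k hk => ?_)
    exact sub_ne_zero.2 (hl k (Finset.ne_of_mem_erase hk))
  have hcont : ContinuousAt A e := by
    refine continuousAt_pi.2 fun i => continuousAt_pi.2 fun j => ?_
    simpa using (hs (Pi.single i 1) (Pi.single j 1)).continuous.continuousAt (x := e)
  have htend : Filter.Tendsto (fun d => (d, eig (A d) l)) (𝓝 e) (𝓝 (e, lam)) :=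
    continuousAt_id.prodMk (continuousAt_eig hA hcont l)
  refine (hc.contDiffAt_implicitFunction two_ne_zero hinv).congr_of_eventuallyEq ?_
  filter_upwards [htend.eventually
    (hc.eventually_apply_eq_iff_implicitFunction two_ne_zero hinv)] with d hd
  exact (hd.1 (by rw [hΦ0]; exact det_shifted_eig hU (hA d) l)).symm

/-! ### Second-order perturbation of a simple eigenvalue -/

/-- Second-order perturbation of a vanishing determinant at a diagonal matrix with the single zero
`a l` on its diagonal: the derivatives of the `l`-th diagonal entry are determined by the
off-diagonal entries. -/
theorem jet_of_det_eq_zero {B : ℝ → Matrix (Fin 3) (Fin 3) ℝ} {a : Fin 3 → ℝ}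
    {b c : Fin 3 → Fin 3 → ℝ}
    (hB : ∀ i k, HasJetTwo (fun s => B s i k) (diagonal a i k) (b i k) (c i k))
    (hdet : ∀ᶠ s in 𝓝 0, (B s).det = 0) (l : Fin 3) (hal : a l = 0)
    (ha : ∀ k, k ≠ l → a k ≠ 0) :
    b l l = 0 ∧ c l l = ∑ k ∈ Finset.univ.erase l, 2 / a k * (b k l * b l k) := by
  have hd := ((((((((hB 0 0).mul (hB 1 1)).mul (hB 2 2)).sub
    (((hB 0 0).mul (hB 1 2)).mul (hB 2 1))).sub
    (((hB 0 1).mul (hB 1 0)).mul (hB 2 2))).add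
    (((hB 0 1).mul (hB 1 2)).mul (hB 2 0))).add
    (((hB 0 2).mul (hB 1 0)).mul (hB 2 1))).sub
    (((hB 0 2).mul (hB 1 1)).mul (hB 2 0)))
  have h0 := (HasJetTwo.const 0).congr_of_eventuallyEq hdet
  simp only [det_fin_three] at h0
  obtain ⟨-, e1, e2⟩ := hd.unique h0
  clear hd h0 hdet hB
  -- The term `k = l` may be added to the sum: it is `2 / 0 = 0` times a number.
  rw [Finset.sum_erase _ (by simp [hal]), Fin.sum_univ_three]
  have n0 := ha 0
  have n1 := ha 1
  have n2 := ha 2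
  clear ha
  fin_cases l <;>
  · simp at e1 e2 hal n0 n1 n2
    simp [hal, n0, n1, n2] at e1 e2 ⊢
    refine ⟨e1, ?_⟩
    simp [e1] at e2
    field_simp
    linear_combination e2

/-! ### Smoothness and invariance of the perturbed covariance -/

section Cost

variable {M : ℕ} (C : Fin M → Matrix I4 I4 ℝ) (T : Fin M → SE3)

/-- The linear map from the stacked perturbation to the matrix `⌊φ_j⌋`. -/
def skewPart (j : Fin M) : (Idx M → ℝ) →ₗ[ℝ] Matrix (Fin 3) (Fin 3) ℝ where
  toFun d := skew fun i => d (j, Sum.inl i)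
  map_add' _ _ := skew_add _ _
  map_smul' s _ := skew_smul s _

theorem contDiff_motion_mulVec (x : Fin 3 → ℝ) (j : Fin M) (a : I4) :
    ContDiff ℝ 2 fun d : Idx M → ℝ => ((motion fun b => d (j, b))ᵀ *ᵥ hom x) a := by
  simp only [motion_transpose_mulVec_hom]
  rcases a with i | i
  · simp only [Sum.elim_inl, Matrix.mulVec, dotProduct, transpose_apply]
    exact ContDiff.sum fun k _ => (contDiff_exp_apply (skewPart j) k i).mul contDiff_const
  · simp only [Sum.elim_inr, dotProduct]
    fun_prop

theorem contDiff_covA (x y : Fin 3 → ℝ) :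
    ContDiff ℝ 2 fun d : Idx M → ℝ => x ⬝ᵥ covA (merged C (boxplus T d)) *ᵥ y := by
  simp only [dotProduct_covA_mulVec, countN_merged_boxplus, dotProduct_merged_boxplus_mulVec,
    motion_transpose_mulVec_last]
  have h := contDiff_motion_mulVec (M := M)
  have hD : ∀ j v a, ContDiff ℝ 2 fun d : Idx M → ℝ =>
      (moved C T j *ᵥ (motion fun b => d (j, b))ᵀ *ᵥ hom v) a := fun j v a => by
    change ContDiff ℝ 2 fun d : Idx M → ℝ =>
      ∑ k, moved C T j a k * ((motion fun b => d (j, b))ᵀ *ᵥ hom v) k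
    exact ContDiff.sum fun k _ => contDiff_const.mul (h v j k)
  refine (contDiff_const.mul ?_).sub (contDiff_const.mul (ContDiff.mul ?_ ?_))
  · exact ContDiff.sum fun j _ => ContDiff.sum fun a _ => (h x j a).mul (hD j y a)
  · exact ContDiff.sum fun j _ => ContDiff.sum fun a _ => (h x j a).mul contDiff_const
  · exact ContDiff.sum fun j _ => ContDiff.sum fun a _ => (h y j a).mul contDiff_const

theorem eq_of_forall_dotProduct_mulVec {n : Type*} [Fintype n] {A B : Matrix n n ℝ}
    (h : ∀ x y, x ⬝ᵥ A *ᵥ y = x ⬝ᵥ B *ᵥ y) : A = B := by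
  classical
  ext i j
  simpa using h (Pi.single i 1) (Pi.single j 1)

/-- A common motion of all poses conjugates the covariance by its rotation. -/
theorem covA_merged_boxplus_const (hC : ∀ j, (C j).IsSymm) (hN : countN (merged C T) ≠ 0)
    (w : I6 → ℝ) :
    covA (merged C (boxplus T fun i => w i.2)) =
      (expRot fun i => w (Sum.inl i)).1 * covA (merged C T) *
        (expRot fun i => w (Sum.inl i)).1ᵀ := by
  refine eq_of_forall_dotProduct_mulVec fun x y => ?_
  set R := (expRot fun i => w (Sum.inl i)).1
  set τ : Fin 3 → ℝ := fun i => w (Sum.inr i)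
  have hform : ∀ u v, u ⬝ᵥ merged C (boxplus T fun i => w i.2) *ᵥ v =
      ((motion w)ᵀ *ᵥ u) ⬝ᵥ merged C T *ᵥ ((motion w)ᵀ *ᵥ v) := fun u v => by
    rw [dotProduct_merged_boxplus_mulVec, dotProduct_merged_mulVec]
  have hz : ∀ v, (motion w)ᵀ *ᵥ hom v = hom (Rᵀ *ᵥ v) + (τ ⬝ᵥ v) • last := fun v => by
    rw [motion_transpose_mulVec_hom]
    ext (i | i) <;> simp [hom, last, R, τ]
  have hsymm : ∀ v, last ⬝ᵥ merged C T *ᵥ v = v ⬝ᵥ merged C T *ᵥ last := fun v => by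
    rw [dotProduct_mulVec, ← mulVec_transpose, (merged_isSymm C hC T).eq, dotProduct_comm]
  have hR : x ⬝ᵥ (R * covA (merged C T) * Rᵀ) *ᵥ y =
      (Rᵀ *ᵥ x) ⬝ᵥ covA (merged C T) *ᵥ (Rᵀ *ᵥ y) := dotProduct_mul_mul_transpose _ _ _ _
  rw [hR, dotProduct_covA_mulVec, dotProduct_covA_mulVec, countN_merged_boxplus]
  simp only [hform, hz, motion_transpose_mulVec_last, mulVec_add, mulVec_smul, add_dotProduct,
    smul_dotProduct, dotProduct_add, dotProduct_smul, smul_eq_mul, hsymm (hom _), ← countN_eq]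
  field_simp
  ring

theorem cost_boxplus_const (hC : ∀ j, (C j).IsSymm) (hN : countN (merged C T) ≠ 0) (l : Fin 3)
    (w : I6 → ℝ) : cost C l (boxplus T fun i => w i.2) = cost C l T := by
  rw [cost, cost, covA_merged_boxplus_const C T hC hN,
    eig_conj (covA_isHermitian (merged_isSymm C hC T))]
  exact mul_eq_one_comm.1 (exp_skew_mul_transpose _)

theorem boxplus_zero : boxplus T 0 = T := by
  funext j
  have h0 : skew (fun _ => (0 : ℝ)) = 0 := skew_zero
  have hr : expRot (fun _ => (0 : ℝ)) = 1 := Subtype.ext (by simp [expRot, h0])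
  simp only [boxplus, SE3.boxplus, Pi.zero_apply, hr]
  rcases T j with ⟨R, t⟩
  congr 1
  · exact one_mul R
  · ext i
    simp

/-! ### Jacobian and Hessian of the cost -/

theorem gRow_symm (x y : Fin 3 → ℝ) : gRow C T x y = gRow C T y x :=
  funext fun i => congrFun (add_comm _ _) i.2

theorem twiceDifferentiableAt_of_contDiffAt {f : (Fin M → SE3) → ℝ}
    (hf : ContDiffAt ℝ 2 (fun d => f (boxplus T d)) 0) : TwiceDifferentiableAt f T :=
  ⟨(hf.eventually (by simp)).mono fun _ hd => hd.differentiableAt (by simp),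
    (hf.fderiv_right (m := 1) (by norm_num)).differentiableAt (by simp)⟩

theorem jacobian_dotProduct (f : (Fin M → SE3) → ℝ) (w : Idx M → ℝ) :
    jacobian f T ⬝ᵥ w = fderiv ℝ (fun d => f (boxplus T d)) 0 w := by
  conv_rhs => rw [pi_eq_sum_univ' w, map_sum]
  simp only [dotProduct, jacobian, map_smul, smul_eq_mul, mul_comm]

theorem hessian_apply {f : (Fin M → SE3) → ℝ}
    (hf : ContDiffAt ℝ 2 (fun d => f (boxplus T d)) 0) (i j : Idx M) :
    hessian f T i j =
      fderiv ℝ (fderiv ℝ fun d => f (boxplus T d)) 0 (Pi.single j 1) (Pi.single i 1) := by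
  have h := (twiceDifferentiableAt_of_contDiffAt T hf).2.hasFDerivAt.clm_apply
    (hasFDerivAt_const (Pi.single i (1 : ℝ)) (0 : Idx M → ℝ))
  rw [hessian, Matrix.of_apply, h.fderiv]
  simp

theorem hessian_transpose {f : (Fin M → SE3) → ℝ}
    (hf : ContDiffAt ℝ 2 (fun d => f (boxplus T d)) 0) : (hessian f T)ᵀ = hessian f T := by
  ext i j
  rw [transpose_apply, hessian_apply T hf, hessian_apply T hf]
  exact hf.isSymmSndFDerivAt (by simp) _ _

theorem dotProduct_hessian {f : (Fin M → SE3) → ℝ}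
    (hf : ContDiffAt ℝ 2 (fun d => f (boxplus T d)) 0) (w : Idx M → ℝ) :
    w ⬝ᵥ hessian f T *ᵥ w = fderiv ℝ (fderiv ℝ fun d => f (boxplus T d)) 0 w w := by
  have h : ∀ {F : Type} [NormedAddCommGroup F] [NormedSpace ℝ F] (L : (Idx M → ℝ) →L[ℝ] F),
      L w = ∑ i, w i • L (Pi.single i 1) := fun L => by
    conv_lhs => rw [pi_eq_sum_univ' w, map_sum]
    simp only [map_smul]
  rw [h (fderiv ℝ (fderiv ℝ fun d => f (boxplus T d)) 0), _root_.sum_apply]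
  simp only [_root_.smul_apply, smul_eq_mul]
  simp only [h (fderiv ℝ (fderiv ℝ fun d => f (boxplus T d)) 0 _), ← hessian_apply T hf,
    dotProduct, Matrix.mulVec, Finset.mul_sum, smul_eq_mul]
  rw [Finset.sum_comm]
  exact Finset.sum_congr rfl fun i _ => Finset.sum_congr rfl fun j _ => by ring

/-- Symmetric matrices with the same quadratic form are equal. -/
theorem eq_of_forall_quadForm {n : Type*} [Fintype n] {A B : Matrix n n ℝ}
    (hA : Aᵀ = A) (hB : Bᵀ = B) (h : ∀ w, w ⬝ᵥ A *ᵥ w = w ⬝ᵥ B *ᵥ w) : A = B := by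
  refine eq_of_forall_dotProduct_mulVec fun x y => ?_
  have comm : ∀ D : Matrix n n ℝ, Dᵀ = D → y ⬝ᵥ D *ᵥ x = x ⬝ᵥ D *ᵥ y := fun D hD => by
    rw [dotProduct_mulVec, ← mulVec_transpose, hD, dotProduct_comm]
  have hxy := h (x + y)
  simp only [mulVec_add, add_dotProduct, dotProduct_add, comm A hA, comm B hB, h x, h y] at hxy
  linarith

theorem hasJetTwo_cost {l : Fin 3} (hf : ContDiffAt ℝ 2 (fun d => cost C l (boxplus T d)) 0)
    (w : Idx M → ℝ) :
    HasJetTwo (fun s : ℝ => cost C l (boxplus T (s • w))) (cost C l T)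
      (jacobian (cost C l) T ⬝ᵥ w) (w ⬝ᵥ hessian (cost C l) T *ᵥ w) := by
  have h := HasJetTwo.of_contDiffAt hf w
  rwa [boxplus_zero, ← jacobian_dotProduct, ← dotProduct_hessian T hf] at h

/-- The characteristic equation in the eigenbasis at `T` determines the jet of the eigenvalue. -/
theorem jet_cost (hC : ∀ j, (C j).IsSymm) {U : Matrix (Fin 3) (Fin 3) ℝ} (hU : U * Uᵀ = 1)
    (hAU : ∀ k, covA (merged C T) *ᵥ U k = eig (covA (merged C T)) k • U k) (l : Fin 3)
    (hl : ∀ k, k ≠ l → eig (covA (merged C T)) k ≠ eig (covA (merged C T)) l)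
    (hf : ContDiffAt ℝ 2 (fun d => cost C l (boxplus T d)) 0) (w : Idx M → ℝ) :
    jacobian (cost C l) T ⬝ᵥ w = gRow C T (U l) (U l) ⬝ᵥ w ∧
    w ⬝ᵥ hessian (cost C l) T *ᵥ w = w ⬝ᵥ HMat C T (U l) *ᵥ w +
      ∑ k ∈ Finset.univ.erase l, 2 / (eig (covA (merged C T)) l - eig (covA (merged C T)) k) *
        (gRow C T (U k) (U l) ⬝ᵥ w) ^ 2 := by
  have hm := hasJetTwo_cost C T hf w
  -- Only the second derivative of the `l`-th diagonal entry enters the conclusion.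
  have hb : ∀ i k, ∃ c, (i = l ∧ k = l → c = w ⬝ᵥ HMat C T (U l) *ᵥ w) ∧
      HasJetTwo (fun s : ℝ => U i ⬝ᵥ covA (merged C (boxplus T (s • w))) *ᵥ U k)
        (U i ⬝ᵥ covA (merged C T) *ᵥ U k) (gRow C T (U i) (U k) ⬝ᵥ w) c := by
    intro i k
    by_cases h : i = l ∧ k = l
    · obtain ⟨rfl, rfl⟩ := h
      exact ⟨_, fun _ => rfl, hasJetTwo_covA_self C T hC _ w⟩
    · obtain ⟨c, hc⟩ := exists_hasJetTwo_covA C T hC (U i) (U k) w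
      exact ⟨c, fun h' => absurd h' h, hc⟩
  choose c hcl hc using hb
  have hB : ∀ i k, HasJetTwo
      (fun s : ℝ => shifted U (covA (merged C (boxplus T (s • w))))
        (cost C l (boxplus T (s • w))) i k)
      (diagonal (fun k => eig (covA (merged C T)) k - cost C l T) i k) _ _ := fun i k => by
    rw [← shifted_eigenbasis hU hAU]
    exact (hc i k).sub (hm.mul (HasJetTwo.const ((1 : Matrix (Fin 3) (Fin 3) ℝ) i k)))
  obtain ⟨h1, h2⟩ := jet_of_det_eq_zero hB
    (.of_forall fun s => det_shifted_eig hU (covA_isHermitian (merged_isSymm C hC _)) l)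
    l (sub_self _) fun k hk => sub_ne_zero.2 (hl k hk)
  simp only [Matrix.one_apply_eq, mul_one, mul_zero, add_zero] at h1 h2
  rw [hcl l l ⟨rfl, rfl⟩] at h2
  refine ⟨(sub_eq_zero.1 h1).symm, ?_⟩
  rw [← sub_eq_iff_eq_add', ← neg_sub, h2, ← Finset.sum_neg_distrib]
  refine Finset.sum_congr rfl fun k hk => ?_
  have hk' := Finset.ne_of_mem_erase hk
  have hak : eig (covA (merged C T)) k - cost C l T =
      -(eig (covA (merged C T)) l - eig (covA (merged C T)) k) := (neg_sub _ _).symm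
  rw [Matrix.one_apply_ne hk', Matrix.one_apply_ne hk'.symm, gRow_symm C T (U l) (U k), hak,
    div_neg]
  ring

end Cost

end LidarBA

theorem theorem4 {M : ℕ} (C : Fin M → Matrix I4 I4 ℝ) (hC : ∀ j, (C j).IsSymm)
    (T : Fin M → SE3) (hN : countN (merged C T) ≠ 0)
    (u : Fin 3 → Fin 3 → ℝ) (hu : ∀ i k, u i ⬝ᵥ u k = if i = k then 1 else 0)
    (huA : ∀ k, covA (merged C T) *ᵥ u k = eig (covA (merged C T)) k • u k)
    (l : Fin 3)
    (hl : ∀ k, k ≠ l → eig (covA (merged C T)) k ≠ eig (covA (merged C T)) l) :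
    TwiceDifferentiableAt (cost C l) T ∧
    jacobian (cost C l) T = gRow C T (u l) (u l) ∧
    hessian (cost C l) T =
      HMat C T (u l) +
        (∑ k ∈ Finset.univ.erase l,
          (2 / (eig (covA (merged C T)) l - eig (covA (merged C T)) k)) •
            vecMulVec (gRow C T (u k) (u l)) (gRow C T (u k) (u l))) ∧
    (∀ w : I6 → ℝ,
      jacobian (cost C l) T ⬝ᵥ (fun i : Idx M => w i.2) = 0 ∧
      (fun i : Idx M => w i.2) ⬝ᵥ (hessian (cost C l) T *ᵥ (fun i : Idx M => w i.2)) = 0) ∧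
    (∀ p, C p = 0 → ∀ a, jacobian (cost C l) T (p, a) = 0) ∧
    (∀ p q, C p = 0 ∨ C q = 0 → ∀ a b, hessian (cost C l) T (p, a) (q, b) = 0) := by
  let U : Matrix (Fin 3) (Fin 3) ℝ := u
  have hU : U * Uᵀ = 1 := by
    ext i k
    rw [Matrix.one_apply, ← hu i k]
    rfl
  have hf : ContDiffAt ℝ 2 (fun d => cost C l (boxplus T d)) 0 := by
    refine contDiffAt_eig (A := fun d => covA (merged C (boxplus T d))) (U := U)
      (fun d => covA_isHermitian (merged_isSymm C hC _)) (contDiff_covA C T) hU 0 ?_ l ?_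
    · rwa [boxplus_zero]
    · rwa [boxplus_zero]
  have hjet := jet_cost C T hC hU huA l hl hf
  have hJ : jacobian (cost C l) T = gRow C T (u l) (u l) :=
    dotProduct_eq _ _ fun w => (hjet w).1
  have hH : hessian (cost C l) T = HMat C T (u l) +
      (∑ k ∈ Finset.univ.erase l,
        (2 / (eig (covA (merged C T)) l - eig (covA (merged C T)) k)) •
          vecMulVec (gRow C T (u k) (u l)) (gRow C T (u k) (u l))) := by
    refine eq_of_forall_quadForm (hessian_transpose T hf) ?_ fun w => ?_
    · simp only [transpose_add, transpose_sum, transpose_smul, transpose_vecMulVec,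
        HMat_transpose C T hC]
    · rw [(hjet w).2, add_mulVec, dotProduct_add, sum_mulVec, dotProduct_sum]
      congr 1
      refine Finset.sum_congr rfl fun k _ => ?_
      rw [smul_mulVec, dotProduct_smul, vecMulVec_mulVec, op_smul_eq_smul, dotProduct_smul,
        dotProduct_comm w, smul_eq_mul, smul_eq_mul, ← sq]
  refine ⟨twiceDifferentiableAt_of_contDiffAt T hf, hJ, hH, fun w => ?_, fun p hp a => ?_,
    fun p q hpq a b => ?_⟩
  · have h := hasJetTwo_cost C T hf fun i => w i.2
    have hconst : (fun s : ℝ => cost C l (boxplus T (s • fun i : Idx M => w i.2))) =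
        fun _ => cost C l T :=
      funext fun s => cost_boxplus_const C T hC hN l (s • w)
    rw [hconst] at h
    exact (h.unique (HasJetTwo.const _)).2
  · rw [hJ]
    exact gRow_eq_zero C T hp _ _ a
  · rw [hH, Matrix.add_apply, HMat_eq_zero C T hpq, zero_add, Matrix.sum_apply]
    refine Finset.sum_eq_zero fun k _ => ?_
    rcases hpq with h | h <;> simp [vecMulVec_apply, gRow_eq_zero C T h]
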